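/- There is an absolute constant $C>0$ such that the following holds. Let $n\ge 2$, $K\ge 2$, $d\in\mathbb N$, $\varepsilon>0$, $\alpha\in(0,1/e)$. Let $\phi:\mathcal S\times\mathcal A\to\mathbb R^d$ be a (measurable) feature map with $\|\phi(s,a)\|_2\le L$ for all $(s,a)$, and let $\Theta_B=\{\theta\in\mathbb R^d:\langle\mathbf 1,\theta\rangle=0,\ \|\theta\|_2\le B\}$ and $\theta^*\in\Theta_B$. Let $(s_t,a_{t,1},\dots,a_{t,K},y_t,\widetilde y_t)$, $1\le t\le n$, be i.i.d., where $s_t\sim\rho$, $(a_{t,1},\dots,a_{t,K})\sim\mu(\cdot\mid s_t)$, the label $y_t\in\{1,\dots,K\}$ follows the Plackett–Luce top-choice model with parameter $\theta^*$, i.e. $y_t=k$ has conditional probability $p_{t,k}(\theta^*)$, where $$p_{t,k}(\theta)=\frac{\exp(\phi(s_t,a_{t,k})^\top\theta)}{\sum_{j=1}^K\exp(\phi(s_t,a_{t,j})^\top\theta)},$$ and $\widetilde y_t$ is the output of $K$-ary randomized response on $y_t$: $\widetilde y_t=y_t$ with conditional probability $\frac{e^\varepsilon}{e^\varepsilon+K-1}$,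 and $\widetilde y_t=y'$ with conditional probability $\frac1{e^\varepsilon+K-1}$ for each $y'\ne y_t$. Assume the coverage condition with $\kappa>0$: for all $i\ne j$, $\lambda_{\min}\big(\mathbb E[x_{i,j}x_{i,j}^\top]\big)\ge\kappa$, where $x_{i,j}=\phi(s,a_i)-\phi(s,a_j)$, $s\sim\rho$, $(a_1,\dots,a_K)\sim\mu(\cdot\mid s)$. Put $\gamma=e^{-4LB}/2$. Let $\hat\theta_1=0$ and, for $1\le t\le n$, $$\hat\theta_{t+1}=\Pi_{\Theta_B}\big(\hat\theta_t-\eta_t\hat g_t\big),\qquad \hat g_t=\frac{\sum_{y=1}^K\nabla\log p_{t,y}(\hat\theta_t)}{e^\varepsilon+K-1}-\nabla\log p_{t,\widetilde y_t}(\hat\theta_t),$$ where $\Pi_{\Theta_B}$ is the Euclidean projection onto $\Theta_B$, with step sizes $$\eta_t=\frac{c}{\gamma_{K,\varepsilon}\,\kappa\,t},\qquad \gamma_{K,\varepsilon}=\gamma\,\frac{e^\varepsilon-1}{e^\varepsilon+K-1},$$ where $c\in[1,2]$ is arbitrary if $K\ge3$ and $c\in[4/3,2]$ is arbitrary if $K=2$.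 Then $\hat\theta_{\text{SGD-KRR}}:=\hat\theta_{n+1}$ satisfies, with probability at least $1-\alpha$, $$\big\|\hat\theta_{\text{SGD-KRR}}-\theta^*\big\|_2\le C\cdot\frac{L}{\gamma\kappa}\cdot\frac{e^\varepsilon+K-1}{e^\varepsilon-1}\sqrt{\frac{\log(\log(n)/\alpha)}{n}} .$$ -/

import Mathlib

open MeasureTheory ProbabilityTheory
open scoped BigOperators

namespace PlackettLuce

/-- The parameter set `Θ_B` of vectors of Euclidean norm at most `B` whose coordinates sum to `0`. -/
def paramSet (d : ℕ) (B : ℝ) : Set (EuclideanSpace ℝ (Fin d)) :=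
  {θ | ∑ i, θ i = 0 ∧ ‖θ‖ ≤ B}

/-- A nearest point of `s` to `x` (it is unique when `s` is nonempty, closed and convex). -/
noncomputable def proj {d : ℕ} (s : Set (EuclideanSpace ℝ (Fin d)))
    (x : EuclideanSpace ℝ (Fin d)) : EuclideanSpace ℝ (Fin d) :=
  Classical.epsilon fun p => p ∈ s ∧ ∀ q ∈ s, ‖x - p‖ ≤ ‖x - q‖

theorem proj_paramSet_spec {d : ℕ} {B : ℝ} (hB : 0 ≤ B) (x : EuclideanSpace ℝ (Fin d)) :
    proj (paramSet d B) x ∈ paramSet d B ∧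
      ∀ q ∈ paramSet d B, ‖x - proj (paramSet d B) x‖ ≤ ‖x - q‖ := by
  have hcl : IsClosed (paramSet d B) := by
    apply IsClosed.and
    · exact isClosed_eq (by fun_prop) continuous_const
    · exact isClosed_le continuous_norm continuous_const
  have hcpt : IsCompact (paramSet d B) := by
    refine (isCompact_closedBall (0 : EuclideanSpace ℝ (Fin d)) B).of_isClosed_subset hcl ?_
    intro θ hθ
    simpa using hθ.2
  have hne : (paramSet d B).Nonempty := ⟨0, by simp [paramSet, hB]⟩
  obtain ⟨p, hp, hmin⟩ := hcpt.exists_isMinOn hne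
    (f := fun p => ‖x - p‖) (by fun_prop)
  have hex : ∃ p, p ∈ paramSet d B ∧ ∀ q ∈ paramSet d B, ‖x - p‖ ≤ ‖x - q‖ :=
    ⟨p, hp, fun q hq => hmin hq⟩
  exact Classical.epsilon_spec hex

section Model

variable {S A : Type*} {d K : ℕ}

/-- The Plackett–Luce probability that action `k` is the most preferred one, in the context
`x = (s, (a_1, …, a_K))`, under the parameter `θ`. -/
noncomputable def topProb (φ : S → A → EuclideanSpace ℝ (Fin d)) (θ : EuclideanSpace ℝ (Fin d))
    (x : S × (Fin K → A)) (k : Fin K) : ℝ :=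
  Real.exp (inner ℝ (φ x.1 (x.2 k)) θ) / ∑ j, Real.exp (inner ℝ (φ x.1 (x.2 j)) θ)

/-- The probability that `K`-ary randomized response with budget `ε` outputs `y'` on input `y`. -/
noncomputable def krrProb (K : ℕ) (ε : ℝ) (y y' : Fin K) : ℝ :=
  if y' = y then Real.exp ε / (Real.exp ε + K - 1) else 1 / (Real.exp ε + K - 1)

/-- `K`-ary randomized response, as a Markov kernel on labels. -/
noncomputable def krrKernel (K : ℕ) (ε : ℝ) : Kernel (Fin K) (Fin K) where
  toFun y := ∑ y', ENNReal.ofReal (krrProb K ε y y') • Measure.dirac y'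
  measurable' := measurable_of_countable _

/-- The de-biased gradient at the estimate `θ`, on a context `x` with randomized label `y'`. -/
noncomputable def debiasedGrad (φ : S → A → EuclideanSpace ℝ (Fin d)) (ε : ℝ)
    (θ : EuclideanSpace ℝ (Fin d)) (x : S × (Fin K → A)) (y' : Fin K) :
    EuclideanSpace ℝ (Fin d) :=
  (1 / (Real.exp ε + K - 1)) • ∑ y, gradient (fun ϑ => Real.log (topProb φ ϑ x y)) θ
    - gradient (fun ϑ => Real.log (topProb φ ϑ x y')) θ

/-- The iterates of one-pass projected SGD on `n` samples. The entry at `0` is the initial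
estimate `0`; round `t = i + 1` uses sample `i` and step size `η t`. -/
noncomputable def sgdIterates {n : ℕ} (φ : S → A → EuclideanSpace ℝ (Fin d)) (ε B : ℝ)
    (η : ℕ → ℝ) (x : Fin n → S × (Fin K → A)) (y' : Fin n → Fin K) :
    Fin (n + 1) → EuclideanSpace ℝ (Fin d) :=
  Fin.induction 0 fun i θ =>
    proj (paramSet d B) (θ - η ((i : ℕ) + 1) • debiasedGrad φ ε θ (x i) (y' i))

/-- The output of SGD: the estimate after all `n` rounds. -/
noncomputable def sgdKRR {n : ℕ} (φ : S → A → EuclideanSpace ℝ (Fin d)) (ε B : ℝ)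
    (η : ℕ → ℝ) (x : Fin n → S × (Fin K → A)) (y' : Fin n → Fin K) :
    EuclideanSpace ℝ (Fin d) :=
  sgdIterates φ ε B η x y' (Fin.last n)

theorem sum_topProb [NeZero K] (φ : S → A → EuclideanSpace ℝ (Fin d))
    (θ : EuclideanSpace ℝ (Fin d)) (x : S × (Fin K → A)) : ∑ k, topProb φ θ x k = 1 := by
  simp only [topProb]
  rw [← Finset.sum_div]
  exact div_self (Finset.sum_pos (fun _ _ => Real.exp_pos _) Finset.univ_nonempty).ne'

variable [MeasurableSpace S] [MeasurableSpace A]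

theorem measurable_topProb {φ : S → A → EuclideanSpace ℝ (Fin d)}
    (hφ : Measurable (Function.uncurry φ)) (θ : EuclideanSpace ℝ (Fin d)) (k : Fin K) :
    Measurable fun x : S × (Fin K → A) => topProb φ θ x k := by
  have h : ∀ j : Fin K, Measurable fun x : S × (Fin K → A) => φ x.1 (x.2 j) := fun j =>
    hφ.comp (measurable_fst.prodMk ((measurable_pi_apply j).comp measurable_snd))
  have h2 : ∀ j : Fin K, Measurable fun x : S × (Fin K → A) =>
      Real.exp (inner ℝ (φ x.1 (x.2 j)) θ) := fun j =>
    Real.measurable_exp.comp ((h j).inner_const)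
  exact (h2 k).div (Finset.measurable_fun_sum _ fun j _ => h2 j)

/-- The conditional law of the label given the context, as a Markov kernel. -/
noncomputable def topKernel (φ : S → A → EuclideanSpace ℝ (Fin d))
    (hφ : Measurable (Function.uncurry φ)) (θ : EuclideanSpace ℝ (Fin d)) :
    Kernel (S × (Fin K → A)) (Fin K) where
  toFun x := ∑ k, ENNReal.ofReal (topProb φ θ x k) • Measure.dirac k
  measurable' := by
    refine Measure.measurable_of_measurable_coe _ fun s hs => ?_
    simp only [Measure.coe_finsetSum, Finset.sum_apply, Measure.smul_apply, smul_eq_mul]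
    exact Finset.measurable_fun_sum _ fun k _ =>
      ((measurable_topProb hφ θ k).ennreal_ofReal).mul_const _

instance [NeZero K] (φ : S → A → EuclideanSpace ℝ (Fin d))
    (hφ : Measurable (Function.uncurry φ)) (θ : EuclideanSpace ℝ (Fin d)) :
    IsMarkovKernel (topKernel (K := K) φ hφ θ) where
  isProbabilityMeasure x := ⟨by
    change (∑ k, ENNReal.ofReal (topProb φ θ x k) • Measure.dirac k) Set.univ = 1
    simp only [Measure.coe_finsetSum, Finset.sum_apply, Measure.smul_apply, smul_eq_mul,
      measure_univ, mul_one]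
    rw [← ENNReal.ofReal_sum_of_nonneg (fun k _ => by unfold topProb; positivity), sum_topProb,
      ENNReal.ofReal_one]⟩

instance (ε : ℝ) : IsMarkovKernel (krrKernel K ε) where
  isProbabilityMeasure y := ⟨by
    have hK : (1 : ℝ) ≤ K := by exact_mod_cast (Fin.pos y)
    have hpos : 0 < Real.exp ε + K - 1 := by linarith [Real.exp_pos ε]
    change (∑ y', ENNReal.ofReal (krrProb K ε y y') • Measure.dirac y') Set.univ = 1
    simp only [Measure.coe_finsetSum, Finset.sum_apply, Measure.smul_apply, smul_eq_mul,
      measure_univ, mul_one]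
    rw [← ENNReal.ofReal_sum_of_nonneg (fun k _ => by unfold krrProb; split_ifs <;> positivity)]
    have : ∑ y', krrProb K ε y y' = 1 := by
      have h : ∀ y', krrProb K ε y y' = 1 / (Real.exp ε + K - 1) +
          if y' = y then (Real.exp ε - 1) / (Real.exp ε + K - 1) else 0 := by
        intro y'
        unfold krrProb
        split_ifs
        · rw [← add_div]; congr 1; ring
        · ring
      simp only [h, Finset.sum_add_distrib, Finset.sum_const, Finset.card_univ, Fintype.card_fin,
        Finset.sum_ite_eq', Finset.mem_univ, if_true, nsmul_eq_mul]
      field_simp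
      ring
    rw [this, ENNReal.ofReal_one]⟩

/-- The joint law of one sample `(((s, (a_1, …, a_K)), y), ỹ)`: the state is drawn from `ρ`, the
actions from `μ` given the state, the label `y` from the Plackett–Luce model with parameter `θ`
given the context, and `ỹ` from `K`-ary randomized response given `y`. -/
noncomputable def sampleLaw (ρ : Measure S) (μ : Kernel S (Fin K → A))
    (φ : S → A → EuclideanSpace ℝ (Fin d)) (hφ : Measurable (Function.uncurry φ))
    (θ : EuclideanSpace ℝ (Fin d)) (ε : ℝ) :
    Measure (((S × (Fin K → A)) × Fin K) × Fin K) :=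
  ((ρ ⊗ₘ μ) ⊗ₘ topKernel φ hφ θ) ⊗ₘ (krrKernel K ε).comap Prod.snd measurable_snd

instance [NeZero K] (ρ : Measure S) [IsProbabilityMeasure ρ] (μ : Kernel S (Fin K → A))
    [IsMarkovKernel μ] (φ : S → A → EuclideanSpace ℝ (Fin d))
    (hφ : Measurable (Function.uncurry φ)) (θ : EuclideanSpace ℝ (Fin d)) (ε : ℝ) :
    IsProbabilityMeasure (sampleLaw ρ μ φ hφ θ ε) := by
  unfold sampleLaw
  infer_instance

/-- The population covariance matrix of the feature difference `φ(s, a_i) - φ(s, a_j)`. -/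
noncomputable def pairCov (ρ : Measure S) (μ : Kernel S (Fin K → A))
    (φ : S → A → EuclideanSpace ℝ (Fin d)) (i j : Fin K) : Matrix (Fin d) (Fin d) ℝ :=
  Matrix.of fun p q => ∫ x, (φ x.1 (x.2 i) - φ x.1 (x.2 j)) p *
    (φ x.1 (x.2 i) - φ x.1 (x.2 j)) q ∂(ρ ⊗ₘ μ)

/-- Every `pairCov ρ μ φ i j` with `i ≠ j` has smallest eigenvalue at least `κ`. -/
def Coverage (ρ : Measure S) (μ : Kernel S (Fin K → A))
    (φ : S → A → EuclideanSpace ℝ (Fin d)) (κ : ℝ) : Prop :=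
  ∀ i j : Fin K, i ≠ j → (pairCov ρ μ φ i j - κ • (1 : Matrix (Fin d) (Fin d) ℝ)).PosSemidef

end Model

end PlackettLuce

open PlackettLuce

/-! Write M = e^ε + K - 1 and r = (e^ε - 1)/M. Randomized response is r times the identity plus mass
1/M on every label, so averaging over it cancels the correction term of the de-biased gradient and
leaves r times the gradient of the Plackett–Luce negative log-likelihood. That mean field is
strongly monotone around θ*: probabilities stay above e^{-2LB}/K on Θ_B, the logarithm has bounded
slope there, and coverage turns score differences into ‖θ - θ*‖² (`sum_sum_sq_le_sum_topProb_sub`,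
`le_integral_inner_debiasedGrad`).

With step h/t and D the error norm, the expansion of the squared error has a random linear term of
size O(L D). Hoeffding's lemma bounds its exponential moment at a cost proportional to D², which the
drift absorbs (`lintegral_exp_sgd_step`). Hence the exponential moment of n D² is bounded uniformly
in n by induction (`lintegral_exp_sgdKRR_le`), and Markov's inequality gives D² ≲ h² L² log(1/α)/n
(`measure_lt_norm_sgdKRR_sub_le`). No union bound over rounds occurs; the iterated logarithm in the
statement enters only through the comparison `log_inv_le_two_mul_log`. -/

namespace PlackettLuce

/-! ### Projection onto Θ_B, monotonicity of softmax, bound on the gradient. -/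

section Deterministic

theorem convex_paramSet (d : ℕ) (B : ℝ) : Convex ℝ (paramSet d B) := by
  rintro x ⟨hx, hx'⟩ y ⟨hy, hy'⟩ a b ha hb hab
  refine ⟨?_, ?_⟩
  · simp [Finset.sum_add_distrib, ← Finset.mul_sum, hx, hy]
  · calc ‖a • x + b • y‖ ≤ ‖a • x‖ + ‖b • y‖ := norm_add_le _ _
      _ = a * ‖x‖ + b * ‖y‖ := by simp [norm_smul, abs_of_nonneg ha, abs_of_nonneg hb]
      _ ≤ a * B + b * B := by gcongr
      _ = B := by rw [← add_mul, hab, one_mul]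

theorem inner_sub_proj_le_zero {d : ℕ} {B : ℝ} (hB : 0 ≤ B) (x : EuclideanSpace ℝ (Fin d))
    {q : EuclideanSpace ℝ (Fin d)} (hq : q ∈ paramSet d B) :
    inner ℝ (x - proj (paramSet d B) x) (q - proj (paramSet d B) x) ≤ 0 := by
  obtain ⟨hp, hmin⟩ := proj_paramSet_spec hB x
  refine (norm_eq_iInf_iff_real_inner_le_zero (convex_paramSet d B) hp).1 ?_ q hq
  have : Nonempty (paramSet d B) := ⟨⟨_, hp⟩⟩
  refine le_antisymm (le_ciInf fun w => hmin w w.2) ?_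
  exact ciInf_le (f := fun w : paramSet d B => ‖x - w‖)
    ⟨0, by rintro _ ⟨w, rfl⟩; exact norm_nonneg _⟩ ⟨_, hp⟩

/-- Adding the variational inequalities at the two projections p, q gives ‖p - q‖² ≤ ⟨x - y, p - q⟩.
Besides controlling the error, this makes the projection continuous, hence measurable. -/
theorem norm_proj_sub_proj_le {d : ℕ} {B : ℝ} (hB : 0 ≤ B) (x y : EuclideanSpace ℝ (Fin d)) :
    ‖proj (paramSet d B) x - proj (paramSet d B) y‖ ≤ ‖x - y‖ := by
  have h1 := inner_sub_proj_le_zero hB x (proj_paramSet_spec hB y).1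
  have h2 := inner_sub_proj_le_zero hB y (proj_paramSet_spec hB x).1
  set p := proj (paramSet d B) x
  set q := proj (paramSet d B) y
  have h3 : ‖p - q‖ ^ 2 ≤ inner ℝ (x - y) (p - q) := by
    have e : inner ℝ (x - y) (p - q) - ‖p - q‖ ^ 2
        = -(inner ℝ (x - p) (q - p) + inner ℝ (y - q) (p - q)) := by
      rw [← real_inner_self_eq_norm_sq, ← inner_sub_left, ← neg_sub p q, inner_neg_right,
        neg_add_eq_sub, neg_sub, ← inner_sub_left]
      congr 1
      abel
    linarith
  have h4 := h3.trans (real_inner_le_norm _ _)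
  by_contra! h
  nlinarith [norm_nonneg (x - y), norm_nonneg (p - q)]

theorem continuous_proj {d : ℕ} {B : ℝ} (hB : 0 ≤ B) :
    Continuous (proj (paramSet d B)) :=
  (LipschitzWith.of_dist_le_mul (K := 1) fun x y => by
    simpa [dist_eq_norm] using norm_proj_sub_proj_le hB x y).continuous

theorem proj_of_mem {d : ℕ} {B : ℝ} (hB : 0 ≤ B) {q : EuclideanSpace ℝ (Fin d)}
    (hq : q ∈ paramSet d B) : proj (paramSet d B) q = q := by
  have := (proj_paramSet_spec hB q).2 q hq
  rw [sub_self, norm_zero, norm_le_zero_iff, sub_eq_zero] at this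
  exact this.symm

theorem norm_proj_sub_le {d : ℕ} {B : ℝ} (hB : 0 ≤ B) (x : EuclideanSpace ℝ (Fin d))
    {q : EuclideanSpace ℝ (Fin d)} (hq : q ∈ paramSet d B) :
    ‖proj (paramSet d B) x - q‖ ≤ ‖x - q‖ := by
  simpa [proj_of_mem hB hq] using norm_proj_sub_proj_le hB x q

/-- The logarithm has slope at most 1/m on [m, ∞). -/
theorem mul_sq_log_sub_log_le {m x y : ℝ} (hm : 0 < m) (hx : m ≤ x) (hy : m ≤ y) :
    m * (Real.log x - Real.log y) ^ 2 ≤ (x - y) * (Real.log x - Real.log y) := by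
  wlog h : y ≤ x generalizing x y
  · have := this hy hx (le_of_not_ge h)
    nlinarith
  have hx0 := hm.trans_le hx
  have hy0 := hm.trans_le hy
  have h1 : 0 ≤ Real.log x - Real.log y := sub_nonneg.2 (Real.log_le_log hy0 h)
  have h2 : y * (Real.log x - Real.log y) ≤ x - y := by
    have := Real.log_le_sub_one_of_pos (div_pos hx0 hy0)
    rw [Real.log_div hx0.ne' hy0.ne'] at this
    calc y * (Real.log x - Real.log y) ≤ y * (x / y - 1) := by gcongr
      _ = x - y := by field_simp
  nlinarith [mul_le_mul_of_nonneg_right hy (sq_nonneg (Real.log x - Real.log y)),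
    mul_le_mul_of_nonneg_right h2 h1]

/-- The two sides differ by exactly 2(∑(u i - a))². The shift a is free so that it can be the
difference of log-normalizers. -/
theorem sum_sum_sub_sq_le {K : ℕ} (u : Fin K → ℝ) (a : ℝ) :
    ∑ i, ∑ j, (u i - u j) ^ 2 ≤ 2 * K * ∑ i, (u i - a) ^ 2 := by
  have h : ∑ i, ∑ j, (u i - u j) ^ 2
      = 2 * K * ∑ i, (u i - a) ^ 2 - 2 * (∑ i, (u i - a)) ^ 2 := by
    have : ∀ i j, (u i - u j) ^ 2
        = (u i - a) ^ 2 + (u j - a) ^ 2 - 2 * ((u i - a) * (u j - a)) := fun i j => by ring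
    simp only [this, Finset.sum_sub_distrib, Finset.sum_add_distrib, Finset.sum_const,
      Finset.card_univ, Fintype.card_fin, nsmul_eq_mul, ← Finset.mul_sum, ← Finset.sum_mul]
    ring
  rw [h]
  nlinarith [sq_nonneg (∑ i, (u i - a))]

variable {S A : Type*} {d K : ℕ} {φ : S → A → EuclideanSpace ℝ (Fin d)} {L B : ℝ}

theorem topProb_pos [NeZero K] (θ : EuclideanSpace ℝ (Fin d)) (x : S × (Fin K → A))
    (k : Fin K) : 0 < topProb φ θ x k :=
  div_pos (Real.exp_pos _) (Finset.sum_pos (fun _ _ => Real.exp_pos _) Finset.univ_nonempty)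

theorem log_topProb [NeZero K] (θ : EuclideanSpace ℝ (Fin d)) (x : S × (Fin K → A))
    (k : Fin K) : Real.log (topProb φ θ x k) = inner ℝ (φ x.1 (x.2 k)) θ
      - Real.log (∑ j, Real.exp (inner ℝ (φ x.1 (x.2 j)) θ)) := by
  rw [topProb, Real.log_div (Real.exp_pos _).ne'
    (Finset.sum_pos (fun _ _ => Real.exp_pos _) Finset.univ_nonempty).ne', Real.log_exp]

theorem le_topProb [NeZero K] (hL : ∀ s a, ‖φ s a‖ ≤ L) {θ : EuclideanSpace ℝ (Fin d)}
    (hθ : ‖θ‖ ≤ B) (x : S × (Fin K → A)) (k : Fin K) :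
    Real.exp (-2 * L * B) / K ≤ topProb φ θ x k := by
  have hL0 : 0 ≤ L := (norm_nonneg _).trans (hL x.1 (x.2 k))
  have h : ∀ j, |(inner ℝ (φ x.1 (x.2 j)) θ : ℝ)| ≤ L * B := fun j =>
    (abs_real_inner_le_norm _ _).trans
      (mul_le_mul (hL _ _) hθ (norm_nonneg _) hL0)
  have hK : (0 : ℝ) < K := by exact_mod_cast NeZero.pos K
  have hs : ∑ j, Real.exp (inner ℝ (φ x.1 (x.2 j)) θ) ≤ K * Real.exp (L * B) := by
    calc _ ≤ ∑ _j : Fin K, Real.exp (L * B) :=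
        Finset.sum_le_sum fun j _ => Real.exp_le_exp.2 (abs_le.1 (h j)).2
      _ = _ := by simp
  rw [topProb, div_le_div_iff₀ hK
    (Finset.sum_pos (fun _ _ => Real.exp_pos _) Finset.univ_nonempty)]
  calc _ ≤ Real.exp (-2 * L * B) * (K * Real.exp (L * B)) := by gcongr
    _ = Real.exp (-(L * B)) * K := by
      rw [mul_left_comm, ← Real.exp_add, mul_comm]; ring_nf
    _ ≤ _ := by
      gcongr
      exact (abs_le.1 (h k)).1

/-- Strong monotonicity of the softmax map along feature scores. -/
theorem sum_sum_sq_le_sum_topProb_sub [NeZero K] (hL : ∀ s a, ‖φ s a‖ ≤ L)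
    {θ θ' : EuclideanSpace ℝ (Fin d)} (hθ : ‖θ‖ ≤ B) (hθ' : ‖θ'‖ ≤ B)
    (x : S × (Fin K → A)) :
    Real.exp (-2 * L * B) / (2 * K ^ 2) *
      ∑ i, ∑ j, (inner ℝ (φ x.1 (x.2 i) - φ x.1 (x.2 j)) (θ - θ') : ℝ) ^ 2 ≤
    ∑ j, (topProb φ θ x j - topProb φ θ' x j) * inner ℝ (φ x.1 (x.2 j)) (θ - θ') := by
  have hK : (0 : ℝ) < K := by exact_mod_cast NeZero.pos K
  set m := Real.exp (-2 * L * B) / K with hm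
  have hm0 : 0 < m := by positivity
  set u : Fin K → ℝ := fun j => inner ℝ (φ x.1 (x.2 j)) (θ - θ') with hu
  -- Log-probabilities are scores minus a normalizer common to all labels, so their change is the
  -- score change up to one constant.
  obtain ⟨a, ha⟩ : ∃ a, ∀ j, Real.log (topProb φ θ x j) - Real.log (topProb φ θ' x j)
      = u j - a := by
    refine ⟨Real.log (∑ j, Real.exp (inner ℝ (φ x.1 (x.2 j)) θ))
      - Real.log (∑ j, Real.exp (inner ℝ (φ x.1 (x.2 j)) θ')), fun j => ?_⟩
    rw [log_topProb, log_topProb, hu]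
    simp only [inner_sub_right]
    ring
  calc _ = m / (2 * K) * ∑ i, ∑ j, (u i - u j) ^ 2 := by
        simp only [inner_sub_left, hu, hm]
        field_simp
    _ ≤ m / (2 * K) * (2 * K * ∑ i, (u i - a) ^ 2) := by
        gcongr
        exact sum_sum_sub_sq_le u a
    _ = ∑ i, m * (u i - a) ^ 2 := by
        rw [← Finset.mul_sum]
        field_simp
    _ ≤ ∑ j, (topProb φ θ x j - topProb φ θ' x j) * (u j - a) := by
        refine Finset.sum_le_sum fun j _ => ?_
        rw [← ha j]
        exact mul_sq_log_sub_log_le hm0 (le_topProb hL hθ x j) (le_topProb hL hθ' x j)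
    -- The constant a drops out because both probability vectors sum to 1.
    _ = _ := by
        simp only [mul_sub, Finset.sum_sub_distrib, ← Finset.sum_mul, sub_mul, sum_topProb]
        simp only [hu, mul_sub, inner_sub_right, Finset.sum_sub_distrib]
        ring

theorem hasGradientAt_log_topProb [NeZero K] (θ : EuclideanSpace ℝ (Fin d))
    (x : S × (Fin K → A)) (k : Fin K) :
    HasGradientAt (fun ϑ => Real.log (topProb φ ϑ x k))
      (φ x.1 (x.2 k) - ∑ j, topProb φ θ x j • φ x.1 (x.2 j)) θ := by
  have hpos : 0 < ∑ j, Real.exp (inner ℝ (φ x.1 (x.2 j)) θ) :=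
    Finset.sum_pos (fun _ _ => Real.exp_pos _) Finset.univ_nonempty
  have h : ∀ j, HasFDerivAt (fun ϑ : EuclideanSpace ℝ (Fin d) =>
      (inner ℝ (φ x.1 (x.2 j)) ϑ : ℝ)) (innerSL ℝ (φ x.1 (x.2 j))) θ :=
    fun j => (innerSL ℝ (φ x.1 (x.2 j))).hasFDerivAt
  have h2 := (h k).sub ((HasFDerivAt.fun_sum (u := Finset.univ)
    fun j _ => (h j).exp).log hpos.ne')
  rw [hasGradientAt_iff_hasFDerivAt]
  simp only [log_topProb]
  refine h2.congr_fderiv ?_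
  ext v
  simp only [topProb, sub_apply, smul_apply,
    sum_apply, innerSL_apply_apply, InnerProductSpace.toDual_apply_apply,
    inner_sub_left, sum_inner, inner_smul_left, smul_eq_mul, Finset.mul_sum]
  congr 1
  refine Finset.sum_congr rfl fun j _ => ?_
  simp
  ring

theorem debiasedGrad_eq [NeZero K] (ε : ℝ) (θ : EuclideanSpace ℝ (Fin d))
    (x : S × (Fin K → A)) (y' : Fin K) :
    debiasedGrad φ ε θ x y' = (1 / (Real.exp ε + K - 1)) •
      ∑ y, (φ x.1 (x.2 y) - ∑ j, topProb φ θ x j • φ x.1 (x.2 j))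
      - (φ x.1 (x.2 y') - ∑ j, topProb φ θ x j • φ x.1 (x.2 j)) := by
  simp only [debiasedGrad, (hasGradientAt_log_topProb θ x _).gradient]

theorem norm_debiasedGrad_le [NeZero K] (hL : ∀ s a, ‖φ s a‖ ≤ L) {ε : ℝ} (hε : 0 < ε)
    (θ : EuclideanSpace ℝ (Fin d)) (x : S × (Fin K → A)) (y' : Fin K) :
    ‖debiasedGrad φ ε θ x y'‖ ≤ 4 * L := by
  have hL0 : 0 ≤ L := (norm_nonneg _).trans (hL x.1 (x.2 y'))
  have hexp : 1 < Real.exp ε := Real.one_lt_exp_iff.2 hε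
  have hK : (1 : ℝ) ≤ K := by exact_mod_cast NeZero.one_le
  have h1 : ‖∑ j, topProb φ θ x j • φ x.1 (x.2 j)‖ ≤ L := by
    calc _ ≤ ∑ j, ‖topProb φ θ x j • φ x.1 (x.2 j)‖ := norm_sum_le _ _
      _ ≤ ∑ j, topProb φ θ x j * L := by
        refine Finset.sum_le_sum fun j _ => ?_
        rw [norm_smul, Real.norm_of_nonneg (topProb_pos θ x j).le]
        exact mul_le_mul_of_nonneg_left (hL _ _) (topProb_pos θ x j).le
      _ = L := by rw [← Finset.sum_mul, sum_topProb, one_mul]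
  have h2 : ∀ y, ‖φ x.1 (x.2 y) - ∑ j, topProb φ θ x j • φ x.1 (x.2 j)‖ ≤ 2 * L := fun y =>
    (norm_sub_le _ _).trans (by linarith [hL x.1 (x.2 y)])
  rw [debiasedGrad_eq]
  refine (norm_sub_le _ _).trans ?_
  have h3 : ‖(1 / (Real.exp ε + K - 1)) •
      ∑ y, (φ x.1 (x.2 y) - ∑ j, topProb φ θ x j • φ x.1 (x.2 j))‖ ≤ 2 * L := by
    rw [norm_smul, Real.norm_of_nonneg (by apply one_div_nonneg.2; linarith), one_div,
      inv_mul_le_iff₀ (by linarith)]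
    calc _ ≤ ∑ y, ‖φ x.1 (x.2 y) - ∑ j, topProb φ θ x j • φ x.1 (x.2 j)‖ := norm_sum_le _ _
      _ ≤ ∑ _y : Fin K, 2 * L := Finset.sum_le_sum fun y _ => h2 y
      _ = K * (2 * L) := by simp
      -- K ≤ e^ε + K - 1, so the correction term has norm at most 2L whatever ε is.
      _ ≤ _ := by gcongr; linarith
  linarith [h2 y']

end Deterministic

/-! ### Mean of the de-biased gradient and strong monotonicity from coverage. -/

section Moments

variable {S A : Type*} {d K : ℕ} {φ : S → A → EuclideanSpace ℝ (Fin d)} {L B : ℝ}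

theorem krrProb_eq (ε : ℝ) (k k' : Fin K) :
    krrProb K ε k k' = 1 / (Real.exp ε + K - 1) +
      if k' = k then (Real.exp ε - 1) / (Real.exp ε + K - 1) else 0 := by
  unfold krrProb
  split_ifs
  · rw [← add_div]; congr 1; ring
  · ring

theorem sum_krrProb [NeZero K] (ε : ℝ) (k : Fin K) : ∑ k', krrProb K ε k k' = 1 := by
  have hK : (1 : ℝ) ≤ K := by exact_mod_cast NeZero.one_le
  have hpos : 0 < Real.exp ε + K - 1 := by linarith [Real.exp_pos ε]
  simp only [krrProb_eq, Finset.sum_add_distrib, Finset.sum_const, Finset.card_univ,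
    Fintype.card_fin, Finset.sum_ite_eq', Finset.mem_univ, if_true, nsmul_eq_mul]
  field_simp
  ring

theorem sum_krrProb_mul (ε : ℝ) (k : Fin K) (w : Fin K → ℝ) :
    ∑ k', krrProb K ε k k' * w k' = 1 / (Real.exp ε + K - 1) * ∑ k', w k'
      + (Real.exp ε - 1) / (Real.exp ε + K - 1) * w k := by
  simp only [krrProb_eq, add_mul, Finset.sum_add_distrib, ← Finset.mul_sum, ite_mul, zero_mul,
    Finset.sum_ite_eq', Finset.mem_univ, if_true]

/-- The conditional mean of the de-biased gradient given the context, in the direction `v`. -/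
theorem sum_topProb_mul_sum_krrProb_mul_inner [NeZero K] (ε : ℝ)
    (θ θ' v : EuclideanSpace ℝ (Fin d)) (x : S × (Fin K → A)) :
    ∑ k, topProb φ θ' x k * ∑ k', krrProb K ε k k' * inner ℝ (debiasedGrad φ ε θ x k') v =
      (Real.exp ε - 1) / (Real.exp ε + K - 1) *
        ∑ j, (topProb φ θ x j - topProb φ θ' x j) * inner ℝ (φ x.1 (x.2 j)) v := by
  set M := Real.exp ε + K - 1 with hM
  set w : Fin K → ℝ := fun k =>
    inner ℝ (φ x.1 (x.2 k) - ∑ j, topProb φ θ x j • φ x.1 (x.2 j)) v with hw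
  have hg : ∀ k', (inner ℝ (debiasedGrad φ ε θ x k') v : ℝ) = 1 / M * ∑ k, w k - w k' := by
    intro k'
    rw [debiasedGrad_eq, inner_sub_left, real_inner_smul_left, sum_inner]
  -- Averaging over the randomized label adds (1/M) ∑ w from the correction and subtracts the same
  -- amount from the uniform part of the mechanism; what is left is -r times w at the true label.
  simp only [hg, mul_sub, Finset.sum_sub_distrib, ← Finset.sum_mul, sum_krrProb, one_mul,
    sum_krrProb_mul, sum_topProb, mul_add, Finset.sum_add_distrib]
  have hw' : ∑ k, topProb φ θ' x k * w k
      = -∑ j, (topProb φ θ x j - topProb φ θ' x j) * inner ℝ (φ x.1 (x.2 j)) v := by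
    simp only [hw, inner_sub_left, mul_sub, sub_mul, Finset.sum_sub_distrib, ← Finset.sum_mul,
      sum_topProb, sum_inner, real_inner_smul_left]
    ring
  simp only [mul_left_comm (topProb φ θ' x _), ← Finset.mul_sum, hw']
  simp only [Finset.mul_sum, sub_mul, Finset.sum_sub_distrib]
  ring

variable [MeasurableSpace S] [MeasurableSpace A]

theorem measurable_feature (hφ : Measurable (Function.uncurry φ)) (j : Fin K) :
    Measurable fun x : S × (Fin K → A) => φ x.1 (x.2 j) :=
  hφ.comp (measurable_fst.prodMk ((measurable_pi_apply j).comp measurable_snd))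

theorem measurable_topProb_prod (hφ : Measurable (Function.uncurry φ)) (k : Fin K) :
    Measurable fun q : EuclideanSpace ℝ (Fin d) × (S × (Fin K → A)) => topProb φ q.1 q.2 k := by
  have he : ∀ j : Fin K, Measurable fun q : EuclideanSpace ℝ (Fin d) × (S × (Fin K → A)) =>
      Real.exp (inner ℝ (φ q.2.1 (q.2.2 j)) q.1) := fun j =>
    Real.measurable_exp.comp (((measurable_feature hφ j).comp measurable_snd).inner measurable_fst)
  exact (he k).div (Finset.measurable_fun_sum _ fun j _ => he j)

theorem measurable_debiasedGrad_apply [NeZero K] (hφ : Measurable (Function.uncurry φ)) (ε : ℝ)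
    (k : Fin K) : Measurable fun q : EuclideanSpace ℝ (Fin d) × (S × (Fin K → A)) =>
      debiasedGrad φ ε q.1 q.2 k := by
  have hf : ∀ j : Fin K, Measurable
      fun q : EuclideanSpace ℝ (Fin d) × (S × (Fin K → A)) => φ q.2.1 (q.2.2 j) :=
    fun j => (measurable_feature hφ j).comp measurable_snd
  have hb : Measurable fun q : EuclideanSpace ℝ (Fin d) × (S × (Fin K → A)) =>
      ∑ j, topProb φ q.1 q.2 j • φ q.2.1 (q.2.2 j) :=
    Finset.measurable_fun_sum _ fun j _ => (measurable_topProb_prod hφ j).smul (hf j)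
  have hs : Measurable fun q : EuclideanSpace ℝ (Fin d) × (S × (Fin K → A)) =>
      ∑ y, (φ q.2.1 (q.2.2 y) - ∑ j, topProb φ q.1 q.2 j • φ q.2.1 (q.2.2 j)) :=
    Finset.measurable_fun_sum _ fun j _ => (hf j).sub hb
  simp only [debiasedGrad_eq]
  exact (hs.const_smul (1 / (Real.exp ε + K - 1))).sub ((hf k).sub hb)

theorem measurable_debiasedGrad_comp [NeZero K] (hφ : Measurable (Function.uncurry φ)) (ε : ℝ)
    {Y : Type*} [MeasurableSpace Y] {f : Y → EuclideanSpace ℝ (Fin d)}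
    {g : Y → ((S × (Fin K → A)) × Fin K) × Fin K} (hf : Measurable f) (hg : Measurable g) :
    Measurable fun y => debiasedGrad φ ε (f y) (g y).1.1 (g y).2 := by
  have h : Measurable fun q : (EuclideanSpace ℝ (Fin d) × (S × (Fin K → A))) × Fin K =>
      debiasedGrad φ ε q.1.1 q.1.2 q.2 :=
    measurable_from_prod_countable_left (measurable_debiasedGrad_apply hφ ε)
  have h' : Measurable fun y => ((f y, (g y).1.1), (g y).2) := by fun_prop
  generalize debiasedGrad φ ε = F at *
  exact h.comp h'

theorem integral_topKernel [NeZero K] (hφ : Measurable (Function.uncurry φ))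
    (θ : EuclideanSpace ℝ (Fin d)) (x : S × (Fin K → A)) (g : Fin K → ℝ) :
    ∫ k, g k ∂(topKernel φ hφ θ x) = ∑ k, topProb φ θ x k * g k := by
  change ∫ k, g k ∂(∑ k, ENNReal.ofReal (topProb φ θ x k) • Measure.dirac k) = _
  rw [integral_finsetSum_measure fun k _ => (integrable_dirac (by simp)).smul_measure (by simp)]
  simp [ENNReal.toReal_ofReal (topProb_pos θ x _).le]

theorem integral_krrKernel [NeZero K] (ε : ℝ) (k : Fin K) (g : Fin K → ℝ) :
    ∫ k', g k' ∂(krrKernel K ε k) = ∑ k', krrProb K ε k k' * g k' := by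
  have hK : (1 : ℝ) ≤ K := by exact_mod_cast NeZero.one_le
  have hpos : 0 < Real.exp ε + K - 1 := by linarith [Real.exp_pos ε]
  have h0 : ∀ k', 0 ≤ krrProb K ε k k' := fun k' => by
    unfold krrProb; split_ifs <;> positivity
  change ∫ k', g k' ∂(∑ k', ENNReal.ofReal (krrProb K ε k k') • Measure.dirac k') = _
  rw [integral_finsetSum_measure fun k _ => (integrable_dirac (by simp)).smul_measure (by simp)]
  simp [ENNReal.toReal_ofReal (h0 _)]

variable {ρ : Measure S} [IsProbabilityMeasure ρ] {μ : Kernel S (Fin K → A)} [IsMarkovKernel μ]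

theorem integral_sampleLaw [NeZero K] (hφ : Measurable (Function.uncurry φ))
    (θ : EuclideanSpace ℝ (Fin d)) (ε : ℝ) {g : S × (Fin K → A) → Fin K → ℝ} {R : ℝ}
    (hg : ∀ k, Measurable fun x => g x k) (hR : ∀ x k, |g x k| ≤ R) :
    ∫ z, g z.1.1 z.2 ∂(sampleLaw ρ μ φ hφ θ ε) =
      ∫ x, ∑ k, topProb φ θ x k * ∑ k', krrProb K ε k k' * g x k' ∂(ρ ⊗ₘ μ) := by
  have hm : Measurable fun q : (S × (Fin K → A)) × Fin K => g q.1 q.2 :=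
    measurable_from_prod_countable_left hg
  have hi : Integrable (fun z : ((S × (Fin K → A)) × Fin K) × Fin K => g z.1.1 z.2)
      (sampleLaw ρ μ φ hφ θ ε) :=
    Integrable.of_bound (hm.comp (by fun_prop : Measurable
      fun z : ((S × (Fin K → A)) × Fin K) × Fin K => (z.1.1, z.2))).aestronglyMeasurable R
      (.of_forall fun z => hR _ _)
  have hi2 : Integrable (fun q : (S × (Fin K → A)) × Fin K =>
      ∫ k', g q.1 k' ∂(krrKernel K ε q.2)) ((ρ ⊗ₘ μ) ⊗ₘ topKernel φ hφ θ) :=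
    Integrable.integral_compProd hi
  unfold sampleLaw at hi ⊢
  rw [Measure.integral_compProd hi]
  simp only [Kernel.comap_apply, integral_krrKernel] at hi2 ⊢
  rw [Measure.integral_compProd hi2]
  simp only [integral_topKernel]

/-- The quadratic form of `pairCov` at v is the second moment of ⟨x_{i,j}, v⟩; boundedness of φ
allows exchanging sums and integrals. -/
theorem le_integral_inner_sq (hφ : Measurable (Function.uncurry φ))
    (hL : ∀ s a, ‖φ s a‖ ≤ L) {κ : ℝ} (hcov : Coverage ρ μ φ κ) {i j : Fin K} (hij : i ≠ j)
    (v : EuclideanSpace ℝ (Fin d)) :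
    κ * ‖v‖ ^ 2 ≤
      ∫ x, (inner ℝ (φ x.1 (x.2 i) - φ x.1 (x.2 j)) v : ℝ) ^ 2 ∂(ρ ⊗ₘ μ) := by
  have h := (hcov i j hij).dotProduct_mulVec_nonneg v
  have hm : ∀ p, Measurable fun x : S × (Fin K → A) => (φ x.1 (x.2 i) - φ x.1 (x.2 j)) p := by
    intro p
    have := (measurable_feature hφ i).sub (measurable_feature hφ j)
    fun_prop
  have hb : ∀ p (x : S × (Fin K → A)), ‖(φ x.1 (x.2 i) - φ x.1 (x.2 j)) p‖ ≤ 2 * L := fun p x =>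
    (PiLp.norm_apply_le _ p).trans ((norm_sub_le _ _).trans
      (by linarith [hL x.1 (x.2 i), hL x.1 (x.2 j)]))
  have hint : ∀ p q, Integrable (fun x : S × (Fin K → A) =>
      (φ x.1 (x.2 i) - φ x.1 (x.2 j)) p * (φ x.1 (x.2 i) - φ x.1 (x.2 j)) q) (ρ ⊗ₘ μ) := by
    intro p q
    refine Integrable.of_bound ((hm p).mul (hm q)).aestronglyMeasurable ((2 * L) * (2 * L))
      (.of_forall fun x => ?_)
    rw [norm_mul]
    exact mul_le_mul (hb p x) (hb q x) (norm_nonneg _) ((norm_nonneg _).trans (hb p x))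
  have he : ∀ x : S × (Fin K → A), (inner ℝ (φ x.1 (x.2 i) - φ x.1 (x.2 j)) v : ℝ) ^ 2 =
      ∑ p, ∑ q, v p * ((φ x.1 (x.2 i) - φ x.1 (x.2 j)) p *
        (φ x.1 (x.2 i) - φ x.1 (x.2 j)) q) * v q := by
    intro x
    rw [sq, PiLp.inner_apply, Finset.sum_mul_sum]
    refine Finset.sum_congr rfl fun p _ => Finset.sum_congr rfl fun q _ => ?_
    simp only [RCLike.inner_apply, conj_trivial]
    ring
  simp only [he]
  rw [integral_finsetSum _ fun p _ => integrable_finsetSum _ fun q _ =>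
    ((hint p q).const_mul _).mul_const _]
  have he2 : ∀ p, ∫ x, ∑ q, v p * ((φ x.1 (x.2 i) - φ x.1 (x.2 j)) p *
        (φ x.1 (x.2 i) - φ x.1 (x.2 j)) q) * v q ∂(ρ ⊗ₘ μ)
      = ∑ q, v p * pairCov ρ μ φ i j p q * v q := by
    intro p
    rw [integral_finsetSum _ fun q _ => ((hint p q).const_mul _).mul_const _]
    simp only [integral_mul_const, integral_const_mul, pairCov, Matrix.of_apply]
  simp only [he2]
  rw [Matrix.sub_mulVec, dotProduct_sub, Matrix.smul_mulVec, Matrix.one_mulVec,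
    dotProduct_smul] at h
  have h1 : star (v : Fin d → ℝ) ⬝ᵥ (v : Fin d → ℝ) = ‖v‖ ^ 2 := by
    rw [EuclideanSpace.real_norm_sq_eq]
    simp [dotProduct, sq]
  rw [h1, smul_eq_mul] at h
  refine (sub_nonneg.1 h).trans_eq ?_
  simp [dotProduct, Matrix.mulVec, Finset.mul_sum, mul_assoc]

/-- If L ≤ 0 all features vanish, contradicting coverage along a unit vector; such a vector needs d
> 0. -/
theorem pos_of_coverage [NeZero d] (hK : 2 ≤ K) (hφ : Measurable (Function.uncurry φ))
    (hL : ∀ s a, ‖φ s a‖ ≤ L) {κ : ℝ} (hκ : 0 < κ) (hcov : Coverage ρ μ φ κ) : 0 < L := by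
  have h := le_integral_inner_sq hφ hL hcov (i := ⟨0, by omega⟩) (j := ⟨1, by omega⟩)
    (by simp) (EuclideanSpace.single 0 1)
  by_contra! hL0
  have h0 : ∀ s a, φ s a = 0 := fun s a => norm_le_zero_iff.1 ((hL s a).trans hL0)
  simp [h0] at h
  linarith

/-- The population de-biased gradient is strongly monotone at the true parameter. -/
theorem le_integral_inner_debiasedGrad (hK : 2 ≤ K) [NeZero K]
    (hφ : Measurable (Function.uncurry φ)) (hL : ∀ s a, ‖φ s a‖ ≤ L) {κ ε : ℝ} (hε : 0 < ε)
    (hcov : Coverage ρ μ φ κ) {θ θ' : EuclideanSpace ℝ (Fin d)} (hθ : ‖θ‖ ≤ B)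
    (hθ' : ‖θ'‖ ≤ B) :
    Real.exp (-2 * L * B) / 2 * ((Real.exp ε - 1) / (Real.exp ε + K - 1)) * (1 - 1 / K) * κ *
        ‖θ - θ'‖ ^ 2 ≤
      ∫ z, inner ℝ (debiasedGrad φ ε θ z.1.1 z.2) (θ - θ') ∂(sampleLaw ρ μ φ hφ θ' ε) := by
  have hexp : 1 < Real.exp ε := Real.one_lt_exp_iff.2 hε
  have hK1 : (2 : ℝ) ≤ K := by exact_mod_cast hK
  have hmf := fun j : Fin K => measurable_feature (A := A) hφ j
  have hint : ∀ i j, Integrable (fun x : S × (Fin K → A) =>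
      (inner ℝ (φ x.1 (x.2 i) - φ x.1 (x.2 j)) (θ - θ') : ℝ) ^ 2) (ρ ⊗ₘ μ) := by
    intro i j
    refine Integrable.of_bound (C := (2 * L * ‖θ - θ'‖) ^ 2)
      (((hmf i).sub (hmf j)).inner_const.pow_const 2).aestronglyMeasurable
      (.of_forall fun x => ?_)
    rw [norm_pow]
    refine pow_le_pow_left₀ (norm_nonneg _) ((norm_inner_le_norm _ _).trans ?_) 2
    gcongr
    exact (norm_sub_le _ _).trans (by linarith [hL x.1 (x.2 i), hL x.1 (x.2 j)])
  have hmt := fun (ϑ : EuclideanSpace ℝ (Fin d)) (j : Fin K) =>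
    measurable_topProb (A := A) hφ ϑ j
  rw [integral_sampleLaw hφ θ' ε (R := 4 * L * ‖θ - θ'‖)
    (g := fun x k => inner ℝ (debiasedGrad φ ε θ x k) (θ - θ'))]
  rotate_left
  · intro k
    refine Measurable.inner_const ?_
    simp only [debiasedGrad_eq]
    have := fun j => hmt θ j
    fun_prop
  · intro x k
    refine (abs_real_inner_le_norm _ _).trans ?_
    gcongr
    exact norm_debiasedGrad_le hL hε θ x k
  simp only [sum_topProb_mul_sum_krrProb_mul_inner]
  set r := (Real.exp ε - 1) / (Real.exp ε + K - 1) with hr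
  have hr0 : 0 ≤ r := div_nonneg (by linarith) (by linarith)
  -- Coverage speaks only of the K(K - 1) off-diagonal pairs; divided by K² this yields the factor 1
  -- - 1/K.
  have hsum : κ * (K * (K - 1)) * ‖θ - θ'‖ ^ 2 ≤ ∑ i, ∑ j,
      ∫ x, (inner ℝ (φ x.1 (x.2 i) - φ x.1 (x.2 j)) (θ - θ') : ℝ) ^ 2 ∂(ρ ⊗ₘ μ) := by
    calc κ * (K * (K - 1)) * ‖θ - θ'‖ ^ 2
        = ∑ i : Fin K, ∑ j : Fin K, (κ * ‖θ - θ'‖ ^ 2 -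
            if i = j then κ * ‖θ - θ'‖ ^ 2 else 0) := by
          simp [Finset.sum_sub_distrib]
          ring
      _ ≤ _ := by
          refine Finset.sum_le_sum fun i _ => Finset.sum_le_sum fun j _ => ?_
          split_ifs with hij
          · rw [sub_self]
            exact integral_nonneg fun x => sq_nonneg _
          · rw [sub_zero]
            exact le_integral_inner_sq hφ hL hcov hij _
  have hint2 : Integrable (fun x : S × (Fin K → A) => ∑ i, ∑ j,
      (inner ℝ (φ x.1 (x.2 i) - φ x.1 (x.2 j)) (θ - θ') : ℝ) ^ 2) (ρ ⊗ₘ μ) :=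
    integrable_finsetSum _ fun i _ => integrable_finsetSum _ fun j _ => hint i j
  have htop : ∀ ϑ (x : S × (Fin K → A)) j, |topProb φ ϑ x j| ≤ 1 := fun ϑ x j => by
    rw [abs_of_pos (topProb_pos ϑ x j), ← sum_topProb φ ϑ x]
    exact Finset.single_le_sum (f := fun k => topProb φ ϑ x k)
      (fun k _ => (topProb_pos ϑ x k).le) (Finset.mem_univ j)
  have hint3 : Integrable (fun x : S × (Fin K → A) => ∑ j,
      (topProb φ θ x j - topProb φ θ' x j) * (inner ℝ (φ x.1 (x.2 j)) (θ - θ') : ℝ))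
      (ρ ⊗ₘ μ) := by
    refine integrable_finsetSum _ fun j _ => Integrable.of_bound (C := 2 * (L * ‖θ - θ'‖))
      (((hmt θ j).sub (hmt θ' j)).mul (hmf j).inner_const).aestronglyMeasurable
      (.of_forall fun x => ?_)
    rw [norm_mul]
    refine mul_le_mul ?_ ((norm_inner_le_norm _ _).trans (by gcongr; exact hL _ _))
      (norm_nonneg _) (by norm_num)
    refine (norm_sub_le _ _).trans ?_
    simp only [Real.norm_eq_abs]
    linarith [htop θ x j, htop θ' x j]
  rw [integral_const_mul]
  calc _ = r * (Real.exp (-2 * L * B) / (2 * K ^ 2) *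
        (κ * (K * (K - 1)) * ‖θ - θ'‖ ^ 2)) := by
        field_simp
    _ ≤ r * (Real.exp (-2 * L * B) / (2 * K ^ 2) * ∑ i, ∑ j,
        ∫ x, (inner ℝ (φ x.1 (x.2 i) - φ x.1 (x.2 j)) (θ - θ') : ℝ) ^ 2 ∂(ρ ⊗ₘ μ)) := by
        gcongr
    _ = r * ∫ x, Real.exp (-2 * L * B) / (2 * K ^ 2) * ∑ i, ∑ j,
        (inner ℝ (φ x.1 (x.2 i) - φ x.1 (x.2 j)) (θ - θ') : ℝ) ^ 2 ∂(ρ ⊗ₘ μ) := by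
        rw [integral_const_mul, integral_finsetSum _ fun i _ =>
          integrable_finsetSum _ fun j _ => hint i j]
        congr 3
        funext i
        rw [integral_finsetSum _ fun j _ => hint i j]
    _ ≤ _ := by
        refine mul_le_mul_of_nonneg_left (integral_mono (hint2.const_mul _) hint3 fun x => ?_) hr0
        exact sum_sum_sq_le_sum_topProb_sub hL hθ hθ' x

end Moments

/-! ### Exponential moments of the SGD error. -/

section Concentration

/-- Hoeffding's lemma for the lower tail of a bounded variable. -/
theorem lintegral_exp_neg_mul_le {Z : Type*} [MeasurableSpace Z] {ν : Measure Z}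
    [IsProbabilityMeasure ν] {W : Z → ℝ} (hW : Measurable W) {R w r : ℝ}
    (hR : ∀ z, |W z| ≤ R) (hw : w ≤ ∫ z, W z ∂ν) (hr : 0 ≤ r) :
    ∫⁻ z, ENNReal.ofReal (Real.exp (-r * W z)) ∂ν ≤
      ENNReal.ofReal (Real.exp (-r * w + r ^ 2 * R ^ 2 / 2)) := by
  have hmem : ∀ z, W z ∈ Set.Icc (-R) R := fun z => abs_le.1 (hR z)
  have hsub := hasSubgaussianMGF_of_mem_Icc (μ := ν) hW.aemeasurable (.of_forall hmem)
  have hmgf := hsub.mgf_le (-r)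
  have he : ∀ z, Real.exp (-r * W z) =
      Real.exp (-r * ∫ z, W z ∂ν) * Real.exp (-r * (W z - ∫ z, W z ∂ν)) := fun z => by
    rw [← Real.exp_add]
    ring_nf
  have hi : Integrable (fun z => Real.exp (-r * W z)) ν := by
    simp only [he]
    exact (hsub.integrable_exp_mul (-r)).const_mul _
  rw [← ofReal_integral_eq_lintegral_ofReal hi (.of_forall fun z => (Real.exp_pos _).le)]
  refine ENNReal.ofReal_le_ofReal ?_
  simp only [he]
  rw [integral_const_mul, Real.exp_add]
  refine mul_le_mul (Real.exp_le_exp.2 ?_) (hmgf.trans_eq ?_)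
    (integral_nonneg fun z => (Real.exp_pos _).le) (Real.exp_pos _).le
  · nlinarith
  · congr 1
    simp only [NNReal.coe_pow, NNReal.coe_div, coe_nnnorm, NNReal.coe_ofNat, Real.norm_eq_abs,
      div_pow, sq_abs]
    ring

theorem measurable_exp_mul_norm_sub_sq {d : ℕ} {Y : Type*} [MeasurableSpace Y]
    {f : Y → EuclideanSpace ℝ (Fin d)} (hf : Measurable f) (a : ℝ)
    (v : EuclideanSpace ℝ (Fin d)) :
    Measurable fun y => ENNReal.ofReal (Real.exp (a * ‖f y - v‖ ^ 2)) := by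
  fun_prop

variable {S A : Type*} {d K : ℕ} {φ : S → A → EuclideanSpace ℝ (Fin d)} {L B : ℝ}

/-- Earlier iterates ignore the last sample, which permits induction on the number of samples. -/
theorem sgdIterates_castSucc {n : ℕ} (ε : ℝ) (η : ℕ → ℝ)
    (x : Fin (n + 1) → S × (Fin K → A)) (y' : Fin (n + 1) → Fin K) (i : Fin (n + 1)) :
    sgdIterates φ ε B η x y' i.castSucc =
      sgdIterates φ ε B η (fun j => x j.castSucc) (fun j => y' j.castSucc) i := by
  induction i using Fin.induction with
  | zero => rfl
  | succ i ih =>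
    rw [← Fin.succ_castSucc]
    simp only [sgdIterates, Fin.induction_succ] at ih ⊢
    rw [ih]
    rfl

theorem sgdKRR_zero (ε : ℝ) (η : ℕ → ℝ) (x : Fin 0 → S × (Fin K → A)) (y' : Fin 0 → Fin K) :
    sgdKRR φ ε B η x y' = 0 := rfl

theorem sgdKRR_succ {n : ℕ} (ε : ℝ) (η : ℕ → ℝ)
    (x : Fin (n + 1) → S × (Fin K → A)) (y' : Fin (n + 1) → Fin K) :
    sgdKRR φ ε B η x y' = proj (paramSet d B)
      (sgdKRR φ ε B η (fun j => x j.castSucc) (fun j => y' j.castSucc) - η (n + 1) •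
        debiasedGrad φ ε (sgdKRR φ ε B η (fun j => x j.castSucc) (fun j => y' j.castSucc))
          (x (Fin.last n)) (y' (Fin.last n))) := by
  simp only [sgdKRR, ← sgdIterates_castSucc]
  rfl

theorem sgdKRR_mem {n : ℕ} (hB : 0 ≤ B) (ε : ℝ) (η : ℕ → ℝ)
    (x : Fin n → S × (Fin K → A)) (y' : Fin n → Fin K) :
    sgdKRR φ ε B η x y' ∈ paramSet d B := by
  cases n with
  | zero => simp [sgdKRR_zero, paramSet, hB]
  | succ n => exact sgdKRR_succ (φ := φ) ε η x y' ▸ (proj_paramSet_spec hB _).1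

variable [MeasurableSpace S] [MeasurableSpace A]

theorem measurable_sgd_step [NeZero K] (hB : 0 ≤ B) (hφ : Measurable (Function.uncurry φ))
    (ε a : ℝ) {Y : Type*} [MeasurableSpace Y] {f : Y → EuclideanSpace ℝ (Fin d)}
    {g : Y → ((S × (Fin K → A)) × Fin K) × Fin K} (hf : Measurable f) (hg : Measurable g) :
    Measurable fun y =>
      proj (paramSet d B) (f y - a • debiasedGrad φ ε (f y) (g y).1.1 (g y).2) := by
  have h := measurable_debiasedGrad_comp hφ ε hf hg
  generalize debiasedGrad φ ε = F at *
  exact (continuous_proj hB).measurable.comp (hf.sub (h.const_smul a))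

theorem measurable_sgdKRR_comp [NeZero K] (hB : 0 ≤ B) (hφ : Measurable (Function.uncurry φ))
    (ε : ℝ) (η : ℕ → ℝ) {n : ℕ} {Y : Type*} [MeasurableSpace Y]
    {g : Y → Fin n → ((S × (Fin K → A)) × Fin K) × Fin K} (hg : Measurable g) :
    Measurable fun y => sgdKRR φ ε B η (fun t => (g y t).1.1) (fun t => (g y t).2) := by
  induction n with
  | zero => exact measurable_const
  | succ n ih =>
    have h1 : Measurable fun y => fun j : Fin n => g y j.castSucc := by fun_prop
    have h2 : Measurable fun y => g y (Fin.last n) := by fun_prop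
    simp only [sgdKRR_succ]
    exact measurable_sgd_step hB hφ ε (η (n + 1)) (ih h1) h2

variable {ρ : Measure S} [IsProbabilityMeasure ρ] {μ : Kernel S (Fin K → A)} [IsMarkovKernel μ]

/-- Exponential moments of the squared error contract in one projected step. -/
theorem lintegral_exp_sgd_step [NeZero K] (hB : 0 ≤ B) (hφ : Measurable (Function.uncurry φ))
    (hL : ∀ s a, ‖φ s a‖ ≤ L) {ε : ℝ} (hε : 0 < ε) {θ θ' : EuclideanSpace ℝ (Fin d)}
    (hθ' : θ' ∈ paramSet d B) {m h s t : ℝ} (hh : 0 ≤ h) (hs : 0 ≤ s) (ht : 0 < t)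
    (hm : m * ‖θ - θ'‖ ^ 2 ≤
      ∫ z, inner ℝ (debiasedGrad φ ε θ z.1.1 z.2) (θ - θ') ∂(sampleLaw ρ μ φ hφ θ' ε)) :
    ∫⁻ z, ENNReal.ofReal (Real.exp (s * t *
        ‖proj (paramSet d B) (θ - (h / t) • debiasedGrad φ ε θ z.1.1 z.2) - θ'‖ ^ 2))
        ∂(sampleLaw ρ μ φ hφ θ' ε) ≤
      ENNReal.ofReal (Real.exp (16 * L ^ 2 * h ^ 2 * s / t +
        (s * (t - 2 * (h * m)) + 32 * s ^ 2 * h ^ 2 * L ^ 2) * ‖θ - θ'‖ ^ 2)) := by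
  set W : ((S × (Fin K → A)) × Fin K) × Fin K → ℝ :=
    fun z => inner ℝ (debiasedGrad φ ε θ z.1.1 z.2) (θ - θ') with hWdef
  have hWm : Measurable W :=
    (measurable_debiasedGrad_comp hφ ε measurable_const measurable_id).inner_const
  -- The range of W scales with the error, so Hoeffding's quadratic term is a multiple of ‖θ - θ'‖²
  -- and competes directly with the drift.
  have hWb : ∀ z, |W z| ≤ 4 * L * ‖θ - θ'‖ := fun z =>
    (abs_real_inner_le_norm _ _).trans (by gcongr; exact norm_debiasedGrad_le hL hε _ _ _)
  have hstep : ∀ z : ((S × (Fin K → A)) × Fin K) × Fin K, s * t *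
      ‖proj (paramSet d B) (θ - (h / t) • debiasedGrad φ ε θ z.1.1 z.2) - θ'‖ ^ 2 ≤
      (16 * L ^ 2 * h ^ 2 * s / t + s * t * ‖θ - θ'‖ ^ 2) + -(2 * s * h) * W z := by
    intro z
    have h1 := pow_le_pow_left₀ (norm_nonneg _)
      (norm_proj_sub_le hB (θ - (h / t) • debiasedGrad φ ε θ z.1.1 z.2) hθ') 2
    rw [sub_right_comm, norm_sub_sq_real (θ - θ'), real_inner_smul_right, norm_smul,
      real_inner_comm, mul_pow, Real.norm_eq_abs, sq_abs] at h1
    have h2 := pow_le_pow_left₀ (norm_nonneg _)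
      (norm_debiasedGrad_le hL hε θ z.1.1 z.2) 2
    calc _ ≤ s * t * (‖θ - θ'‖ ^ 2 - 2 * (h / t * W z) + (h / t) ^ 2 * (4 * L) ^ 2) := by
          refine mul_le_mul_of_nonneg_left (h1.trans ?_) (by positivity)
          gcongr
      _ = _ := by
          field_simp
          ring
  calc _ ≤ ∫⁻ z, ENNReal.ofReal (Real.exp (16 * L ^ 2 * h ^ 2 * s / t + s * t * ‖θ - θ'‖ ^ 2)) *
        ENNReal.ofReal (Real.exp (-(2 * s * h) * W z)) ∂(sampleLaw ρ μ φ hφ θ' ε) := by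
        refine lintegral_mono fun z => ?_
        rw [← ENNReal.ofReal_mul (Real.exp_pos _).le, ← Real.exp_add]
        exact ENNReal.ofReal_le_ofReal (Real.exp_le_exp.2 (hstep z))
    _ ≤ ENNReal.ofReal (Real.exp (16 * L ^ 2 * h ^ 2 * s / t + s * t * ‖θ - θ'‖ ^ 2)) *
        ENNReal.ofReal (Real.exp (-(2 * s * h) * (m * ‖θ - θ'‖ ^ 2) +
          (2 * s * h) ^ 2 * (4 * L * ‖θ - θ'‖) ^ 2 / 2)) := by
        rw [lintegral_const_mul _ (by fun_prop)]
        gcongr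
        exact lintegral_exp_neg_mul_le hWm hWb hm (by positivity)
    _ = _ := by
        rw [← ENNReal.ofReal_mul (Real.exp_pos _).le, ← Real.exp_add]
        congr 2
        ring

/-- The bound is linear in s in the exponent and holds for all small s, so each round's contraction
can be spent by lowering s in the induction hypothesis. -/
theorem lintegral_exp_sgdKRR_le (hK : 2 ≤ K) [NeZero K] (hφ : Measurable (Function.uncurry φ))
    (hL : ∀ s a, ‖φ s a‖ ≤ L) {ε κ h : ℝ} (hε : 0 < ε) (hcov : Coverage ρ μ φ κ)
    {θ' : EuclideanSpace ℝ (Fin d)} (hθ' : θ' ∈ paramSet d B) (hh : 0 ≤ h)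
    (hm : 2 / 3 ≤ h * (Real.exp (-2 * L * B) / 2 *
      ((Real.exp ε - 1) / (Real.exp ε + K - 1)) * (1 - 1 / K) * κ))
    {η : ℕ → ℝ} (hη : ∀ t : ℕ, η t = h / t) (n : ℕ) {s : ℝ} (hs : 0 ≤ s)
    (hsL : 192 * (h ^ 2 * L ^ 2) * s ≤ 1) :
    ∫⁻ z, ENNReal.ofReal (Real.exp (s * n *
        ‖sgdKRR φ ε B η (fun t => (z t).1.1) (fun t => (z t).2) - θ'‖ ^ 2))
        ∂(Measure.pi fun _ : Fin n => sampleLaw ρ μ φ hφ θ' ε) ≤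
      ENNReal.ofReal (Real.exp (96 * (h ^ 2 * L ^ 2) * s)) := by
  have hB : 0 ≤ B := (norm_nonneg _).trans hθ'.2
  set ν := sampleLaw ρ μ φ hφ θ' ε with hν
  set b := h ^ 2 * L ^ 2 with hb
  have hb0 : 0 ≤ b := by positivity
  induction n generalizing s with
  | zero =>
    simp only [Nat.cast_zero, mul_zero, zero_mul, Real.exp_zero, ENNReal.ofReal_one,
      lintegral_const, measure_univ, mul_one]
    rw [← ENNReal.ofReal_one]
    exact ENNReal.ofReal_le_ofReal (Real.one_le_exp (by positivity))
  | succ n ih =>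
    obtain ⟨T, hT⟩ : ∃ T : (Fin n → ((S × (Fin K → A)) × Fin K) × Fin K) →
        EuclideanSpace ℝ (Fin d), ∀ z, T z =
          sgdKRR φ ε B η (fun t => (z t).1.1) (fun t => (z t).2) := ⟨_, fun _ => rfl⟩
    have hTmem : ∀ z, T z ∈ paramSet d B := fun z => hT z ▸ sgdKRR_mem hB ε η _ _
    have hTm : Measurable T := by
      simp only [funext hT]
      exact measurable_sgdKRR_comp hB hφ ε η measurable_id
    simp only [← hT] at ih
    set F : ((((S × (Fin K → A)) × Fin K) × Fin K) ×
        (Fin n → ((S × (Fin K → A)) × Fin K) × Fin K)) → ENNReal := fun q =>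
      ENNReal.ofReal (Real.exp (s * (n + 1 : ℕ) * ‖proj (paramSet d B)
        (T q.2 - (h / (n + 1 : ℕ)) •
          debiasedGrad φ ε (T q.2)
            q.1.1.1 q.1.2) - θ'‖ ^ 2)) with hF
    have hFm : Measurable F := by
      have h1 := measurable_sgd_step hB hφ ε (h / (n + 1 : ℕ)) (hTm.comp measurable_snd)
        (measurable_fst (α := ((S × (Fin K → A)) × Fin K) × Fin K)
          (β := Fin n → ((S × (Fin K → A)) × Fin K) × Fin K))
      exact measurable_exp_mul_norm_sub_sq h1 _ _
    -- The last sample is split off and integrated first, with the preceding estimate frozen.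
    have hpres := measurePreserving_piFinSuccAbove (fun _ : Fin (n + 1) => ν) (Fin.last n)
    have hn0 : (0 : ℝ) < (n + 1 : ℕ) := by positivity
    calc _ = ∫⁻ z, F (MeasurableEquiv.piFinSuccAbove
          (fun _ => ((S × (Fin K → A)) × Fin K) × Fin K) (Fin.last n) z)
          ∂(Measure.pi fun _ : Fin (n + 1) => ν) := by
          refine lintegral_congr fun z => ?_
          simp only [hF, hT, sgdKRR_succ, hη, MeasurableEquiv.piFinSuccAbove_apply,
            Fin.insertNthEquiv_symm_apply, Fin.removeNth_apply, Fin.succAbove_last]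
      _ = ∫⁻ q, F q ∂(ν.prod (Measure.pi fun _ : Fin n => ν)) := hpres.lintegral_comp hFm
      _ = ∫⁻ z, ∫⁻ z₀, F (z₀, z) ∂ν ∂(Measure.pi fun _ : Fin n => ν) :=
          lintegral_prod_symm _ hFm.aemeasurable
      _ ≤ ∫⁻ z, ENNReal.ofReal (Real.exp (16 * b * s / (n + 1 : ℕ))) *
          ENNReal.ofReal (Real.exp (s * (n - 1 / 6) *
            ‖T z - θ'‖ ^ 2))
          ∂(Measure.pi fun _ : Fin n => ν) := by
          refine lintegral_mono fun z => ?_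
          refine (lintegral_exp_sgd_step hB hφ hL hε hθ' hh hs hn0
            (le_integral_inner_debiasedGrad hK hφ hL hε hcov
              (hTmem z).2 hθ'.2)).trans ?_
          rw [← ENNReal.ofReal_mul (Real.exp_pos _).le, ← Real.exp_add]
          refine ENNReal.ofReal_le_ofReal (Real.exp_le_exp.2 ?_)
          refine add_le_add (le_of_eq (by rw [hb]; ring)) ?_
          refine mul_le_mul_of_nonneg_right ?_ (sq_nonneg _)
          push_cast
          -- The drift removes at least 4/3 from n + 1 and the Hoeffding term returns at most 32/192
          -- = 1/6, leaving n - 1/6.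
          nlinarith [mul_le_mul_of_nonneg_left hm hs, mul_le_mul_of_nonneg_left hsL hs]
      _ = ENNReal.ofReal (Real.exp (16 * b * s / (n + 1 : ℕ))) *
          ∫⁻ z, ENNReal.ofReal (Real.exp (s * (n - 1 / 6) *
            ‖T z - θ'‖ ^ 2))
          ∂(Measure.pi fun _ : Fin n => ν) := by
          exact lintegral_const_mul _ (measurable_exp_mul_norm_sub_sq hTm _ _)
      _ ≤ _ := by
          -- For n = 0 the coefficient n - 1/6 is negative and s cannot be rescaled by 1/n; bounding
          -- the exponential by 1 suffices.
          rcases Nat.eq_zero_or_pos n with rfl | hn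
          · calc _ ≤ ENNReal.ofReal (Real.exp (16 * b * s / (0 + 1 : ℕ))) * ∫⁻ z, 1
                  ∂(Measure.pi fun _ : Fin 0 => ν) := by
                  gcongr
                  rw [← ENNReal.ofReal_one]
                  refine ENNReal.ofReal_le_ofReal (Real.exp_le_one_iff.2 ?_)
                  refine mul_nonpos_of_nonpos_of_nonneg ?_ (sq_nonneg _)
                  push_cast
                  linarith
              _ ≤ _ := by
                  simp only [lintegral_const, measure_univ, mul_one]
                  refine ENNReal.ofReal_le_ofReal (Real.exp_le_exp.2 ?_)
                  push_cast
                  nlinarith [mul_nonneg hb0 hs]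
          · have hn1 : (1 : ℝ) ≤ n := by exact_mod_cast hn
            have hn2 : (0 : ℝ) < n := by linarith
            have hs' : 0 ≤ s * (n - 1 / 6) / n := by
              have : (0 : ℝ) ≤ n - 1 / 6 := by linarith
              positivity
            have hle : s * (n - 1 / 6) / n ≤ s := by
              rw [div_le_iff₀ hn2]
              nlinarith
            have hih := ih hs' ((mul_le_mul_of_nonneg_left hle (by positivity)).trans hsL)
            rw [div_mul_cancel₀ _ hn2.ne'] at hih
            refine (mul_le_mul_right hih _).trans ?_
            rw [← ENNReal.ofReal_mul (Real.exp_pos _).le, ← Real.exp_add]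
            refine ENNReal.ofReal_le_ofReal (Real.exp_le_exp.2 ?_)
            have h1 : 16 * b * s / (n + 1 : ℕ) ≤ 16 * b * s / n := by
              gcongr
              linarith
            -- The constant 96 = 6 · 16 makes the saving of 1/6 pay for the new noise exactly.
            have h2 : 16 * b * s / n + 96 * b * (s * (n - 1 / 6) / n) = 96 * b * s := by
              field_simp
              ring
            linarith

end Concentration

/-! ### Tail bound and the iterated logarithm. -/

section Tail

/-- The worst case is n = 2, where e^{-1/2} < 0.69 < log 2, as 0.69² · e > 1. -/
theorem neg_half_le_log_log {n : ℕ} (hn : 2 ≤ n) : -(1 / 2) ≤ Real.log (Real.log n) := by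
  have h1 : Real.log 2 ≤ Real.log n :=
    Real.log_le_log (by norm_num) (by exact_mod_cast hn)
  have h2 := Real.log_two_gt_d9
  rw [Real.le_log_iff_exp_le (by linarith)]
  have h3 : Real.exp (-(1 / 2)) ^ 2 * Real.exp 1 = 1 := by
    rw [← Real.exp_nat_mul, ← Real.exp_add]
    norm_num
  have h4 := Real.exp_one_gt_d9
  have h5 := Real.exp_pos (-(1 / 2))
  by_contra! h
  have h6 : (0.69 : ℝ) ^ 2 < Real.exp (-(1 / 2)) ^ 2 :=
    pow_lt_pow_left₀ (by linarith) (by norm_num) two_ne_zero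
  nlinarith

/-- For small n, log log n is negative, but doubling costs it at most 1, which is less than log(1/α)
since α < 1/e. -/
theorem log_inv_le_two_mul_log {n : ℕ} (hn : 2 ≤ n) {α : ℝ} (hα : 0 < α)
    (hα' : α < 1 / Real.exp 1) : Real.log α⁻¹ ≤ 2 * Real.log (Real.log n / α) := by
  have h1 := neg_half_le_log_log hn
  have h2 : 0 < Real.log n := Real.log_pos (by exact_mod_cast hn)
  have h3 : Real.log α < -1 := by
    rw [Real.log_lt_iff_lt_exp hα, Real.exp_neg, ← one_div]
    exact hα'
  rw [Real.log_inv, Real.log_div h2.ne' hα.ne']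
  linarith

variable {S A : Type*} {d K : ℕ} {φ : S → A → EuclideanSpace ℝ (Fin d)} {L B : ℝ}
  [MeasurableSpace S] [MeasurableSpace A]
  {ρ : Measure S} [IsProbabilityMeasure ρ] {μ : Kernel S (Fin K → A)} [IsMarkovKernel μ]

theorem measure_lt_norm_sgdKRR_sub_le (hK : 2 ≤ K) [NeZero K]
    (hφ : Measurable (Function.uncurry φ)) (hL : ∀ s a, ‖φ s a‖ ≤ L) (hL0 : 0 < L)
    {ε κ h : ℝ} (hε : 0 < ε) (hcov : Coverage ρ μ φ κ)
    {θ' : EuclideanSpace ℝ (Fin d)} (hθ' : θ' ∈ paramSet d B) (hh : 0 < h)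
    (hm : 2 / 3 ≤ h * (Real.exp (-2 * L * B) / 2 *
      ((Real.exp ε - 1) / (Real.exp ε + K - 1)) * (1 - 1 / K) * κ))
    {η : ℕ → ℝ} (hη : ∀ t : ℕ, η t = h / t) (n : ℕ) {α : ℝ} (hα : 0 < α)
    (hα' : α < 1 / Real.exp 1) :
    Measure.pi (fun _ : Fin n => sampleLaw ρ μ φ hφ θ' ε)
      {z | 288 * (h ^ 2 * L ^ 2) * Real.log α⁻¹ <
        n * ‖sgdKRR φ ε B η (fun t => (z t).1.1) (fun t => (z t).2) - θ'‖ ^ 2} ≤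
      ENNReal.ofReal α := by
  have hB : 0 ≤ B := (norm_nonneg _).trans hθ'.2
  set b := h ^ 2 * L ^ 2 with hb
  have hb0 : 0 < b := by positivity
  -- The largest admissible s is taken; it requires b > 0, hence L > 0.
  have hmgf := lintegral_exp_sgdKRR_le hK hφ hL hε hcov hθ' hh.le hm hη n
    (s := (192 * b)⁻¹) (by positivity) (by rw [← hb]; field_simp; rfl)
  have hmeas := measurable_exp_mul_norm_sub_sq
    (measurable_sgdKRR_comp (K := K) (n := n) hB hφ ε η measurable_id) ((192 * b)⁻¹ * n) θ'
  have hmarkov := (mul_meas_ge_le_lintegral (μ := Measure.pi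
    (fun _ : Fin n => sampleLaw ρ μ φ hφ θ' ε)) hmeas
    (ENNReal.ofReal (Real.exp (1 / 2) * α⁻¹))).trans hmgf
  have hlog : 1 ≤ Real.log α⁻¹ := by
    rw [Real.le_log_iff_exp_le (by positivity)]
    rw [lt_one_div hα (Real.exp_pos 1)] at hα'
    simpa using hα'.le
  have he : 96 * b * (192 * b)⁻¹ = 1 / 2 := by
    field_simp
    norm_num
  rw [← hb, he] at hmarkov
  have hsub : {z : Fin n → ((S × (Fin K → A)) × Fin K) × Fin K | 288 * b * Real.log α⁻¹ <
        n * ‖sgdKRR φ ε B η (fun t => (z t).1.1) (fun t => (z t).2) - θ'‖ ^ 2} ⊆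
      {z | ENNReal.ofReal (Real.exp (1 / 2) * α⁻¹) ≤ ENNReal.ofReal (Real.exp ((192 * b)⁻¹ * n *
        ‖sgdKRR φ ε B η (fun t => (z t).1.1) (fun t => (z t).2) - θ'‖ ^ 2))} := by
    intro z hz
    refine ENNReal.ofReal_le_ofReal ?_
    rw [← Real.exp_log (inv_pos.2 hα), ← Real.exp_add, Real.exp_le_exp, mul_assoc,
      le_inv_mul_iff₀ (by positivity)]
    refine le_trans ?_ (le_of_lt hz)
    -- Since log α⁻¹ ≥ 1, 192(1/2 + log α⁻¹) ≤ 288 log α⁻¹.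
    nlinarith
  replace hmarkov := (mul_le_mul_right (measure_mono hsub) _).trans hmarkov
  rw [ENNReal.ofReal_mul (Real.exp_pos _).le, mul_assoc] at hmarkov
  have h1 := (ENNReal.mul_le_iff_le_inv (by simpa using Real.exp_pos _) (by simp)).1 hmarkov
  rw [ENNReal.inv_mul_cancel (by simpa using Real.exp_pos _) (by simp)] at h1
  have h2 := (ENNReal.mul_le_iff_le_inv (by simpa using hα) (by simp)).1 h1
  rw [mul_one, ← ENNReal.ofReal_inv_of_pos (inv_pos.2 hα), inv_inv] at h2
  exact h2

end Tail

end PlackettLuce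

/-! ### Choice of constants and transfer to the sample space. -/

theorem mainTheorem9 :
    ∃ C : ℝ, 0 < C ∧
      ∀ (S A Ω : Type*) [MeasurableSpace S] [MeasurableSpace A] [MeasurableSpace Ω]
        (P : Measure Ω) [IsProbabilityMeasure P]
        (d K n : ℕ) (_hK : 2 ≤ K) (_hn : 2 ≤ n)
        (ρ : Measure S) [IsProbabilityMeasure ρ]
        (μ : Kernel S (Fin K → A)) [IsMarkovKernel μ]
        (φ : S → A → EuclideanSpace ℝ (Fin d)) (hφ : Measurable (Function.uncurry φ))
        (L B κ ε α c γ : ℝ) (θstar : EuclideanSpace ℝ (Fin d))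
        (_hθ : θstar ∈ paramSet d B) (_hL : ∀ s a, ‖φ s a‖ ≤ L)
        (_hκ : 0 < κ) (_hcov : Coverage ρ μ φ κ)
        (_hε : 0 < ε) (_hα : 0 < α) (_hα' : α < 1 / Real.exp 1)
        (_hc : 1 ≤ c) (_hc' : c ≤ 2) (_hcK : K = 2 → 4 / 3 ≤ c)
        (_hγ : γ = Real.exp (-4 * L * B) / 2)
        (η : ℕ → ℝ)
        (_hη : ∀ t, η t = c * ((Real.exp ε + K - 1) / ((Real.exp ε - 1) * γ * κ * t)))
        (x : Fin n → Ω → S × (Fin K → A)) (y y' : Fin n → Ω → Fin K)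
        (_hlaw : ∀ t, HasLaw (fun ω => ((x t ω, y t ω), y' t ω))
          (sampleLaw ρ μ φ hφ θstar ε) P)
        (_hindep : iIndepFun (fun t ω => ((x t ω, y t ω), y' t ω)) P),
        ENNReal.ofReal (1 - α) ≤
          P {ω | ‖sgdKRR φ ε B η (fun t => x t ω) (fun t => y' t ω) - θstar‖ ≤
            C * (L / (γ * κ)) * ((Real.exp ε + K - 1) / (Real.exp ε - 1)) *
              √(Real.log (Real.log n / α) / n)} := by
  -- 48² = 288 · 2² · 2: the tail constant, the square of c ≤ 2, and the factor from
  -- `log_inv_le_two_mul_log`.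
  refine ⟨48, by norm_num, ?_⟩
  intro S A Ω _ _ _ P _ d K n hK hn ρ _ μ _ φ hφ L B κ ε α c γ θ' hθ' hL hκ hcov hε hα hα'
    hc hc' hcK hγ η hη x y y' hlaw hindep
  have : NeZero K := ⟨by omega⟩
  have hexp : 1 < Real.exp ε := Real.one_lt_exp_iff.2 hε
  have hK1 : (2 : ℝ) ≤ K := by exact_mod_cast hK
  have hn1 : (2 : ℝ) ≤ n := by exact_mod_cast hn
  have hB : 0 ≤ B := (norm_nonneg _).trans hθ'.2
  have hγ0 : 0 < γ := hγ ▸ by positivity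
  have he0 : 0 < Real.exp ε - 1 := by linarith
  have hM0 : 0 < Real.exp ε + K - 1 := by linarith
  have hL0 : 0 ≤ L := by
    obtain ⟨ω⟩ := P.nonempty_of_neZero
    exact (norm_nonneg _).trans (hL (x ⟨0, by omega⟩ ω).1 ((x ⟨0, by omega⟩ ω).2 0))
  -- In dimension 0 coverage does not force L > 0, but the error is 0.
  rcases Nat.eq_zero_or_pos d with rfl | hd
  · have hset : {ω | ‖sgdKRR φ ε B η (fun t => x t ω) (fun t => y' t ω) - θ'‖ ≤
            48 * (L / (γ * κ)) * ((Real.exp ε + K - 1) / (Real.exp ε - 1)) *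
              √(Real.log (Real.log n / α) / n)} = Set.univ := by
      refine Set.eq_univ_of_forall fun ω => ?_
      rw [Set.mem_ofPred_eq, Subsingleton.elim (_ - θ') 0, norm_zero]
      positivity
    rw [hset, measure_univ]
    simpa using hα.le
  have : NeZero d := ⟨hd.ne'⟩
  have hLpos := pos_of_coverage hK hφ hL hκ hcov
  set h := c * (Real.exp ε + K - 1) / ((Real.exp ε - 1) * γ * κ) with hh
  have hh0 : 0 < h := by positivity
  -- At t = 0 both sides are 0 by the division convention; rounds start at t = 1.
  have hηh : ∀ t : ℕ, η t = h / t := fun t => by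
    rw [hη, hh, mul_div_assoc, mul_div_assoc, div_div]
  have hγle : γ ≤ Real.exp (-2 * L * B) / 2 := by
    rw [hγ]
    gcongr
    norm_num
  -- This is where the two ranges of c come from: 1 - 1/K is 1/2 for K = 2 and at least 2/3 for K ≥
  -- 3.
  have hcK' : 2 / 3 ≤ c * (1 - 1 / K) := by
    rcases hK.eq_or_lt with rfl | hK3
    · have := hcK rfl
      push_cast
      linarith
    · have h3 : (3 : ℝ) ≤ K := by exact_mod_cast hK3
      have h4 : (1 : ℝ) / K ≤ 1 / 3 := one_div_le_one_div_of_le (by norm_num) h3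
      nlinarith
  have hm : 2 / 3 ≤ h * (Real.exp (-2 * L * B) / 2 *
      ((Real.exp ε - 1) / (Real.exp ε + K - 1)) * (1 - 1 / K) * κ) := by
    calc 2 / 3 ≤ c * (1 - 1 / K) * 1 := by linarith
      _ ≤ c * (1 - 1 / K) * (Real.exp (-2 * L * B) / 2 / γ) := by
        refine mul_le_mul_of_nonneg_left ((one_le_div hγ0).2 hγle) (by linarith)
      _ = _ := by
        rw [hh]
        generalize (1 - 1 / (K : ℝ)) = r
        field_simp
  set Q := L / (γ * κ) * ((Real.exp ε + K - 1) / (Real.exp ε - 1)) with hQ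
  have hhL : h * L ≤ 2 * Q := by
    have : h * L = c * Q := by
      rw [hh, hQ]
      field_simp
    rw [this]
    gcongr
  have hlog := log_inv_le_two_mul_log hn hα hα'
  have hlog0 : 0 ≤ Real.log α⁻¹ := by
    refine Real.log_nonneg ((one_le_inv₀ hα).2 (hα'.le.trans ?_))
    rw [div_le_one (Real.exp_pos _)]
    exact Real.one_le_exp zero_le_one
  set ν := Measure.pi fun _ : Fin n => sampleLaw ρ μ φ hφ θ' ε
  have hTm := measurable_sgdKRR_comp (K := K) (n := n) hB hφ ε η measurable_id
  have hG : MeasurableSet {z : Fin n → ((S × (Fin K → A)) × Fin K) × Fin K |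
      ‖sgdKRR φ ε B η (fun t => (z t).1.1) (fun t => (z t).2) - θ'‖ ≤
        48 * (L / (γ * κ)) * ((Real.exp ε + K - 1) / (Real.exp ε - 1)) *
              √(Real.log (Real.log n / α) / n)} :=
    measurableSet_le (hTm.sub_const θ').norm measurable_const
  -- Independence makes the joint law of the samples the product measure, where the tail bound
  -- lives.
  have hlawpi := hindep.hasLaw_pi hlaw
  rw [hlawpi.measure_eq hG, ← compl_compl {z : Fin n → _ | _}, prob_compl_eq_one_sub hG.compl,
    ENNReal.ofReal_sub _ hα.le, ENNReal.ofReal_one]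
  refine tsub_le_tsub_left ((measure_mono fun z hz => ?_).trans
    (measure_lt_norm_sgdKRR_sub_le hK hφ hL hLpos hε hcov hθ' hh0 hm hηh n hα hα')) 1
  simp only [Set.mem_compl_iff, Set.mem_ofPred_eq, not_le] at hz ⊢
  have hQ0 : 0 ≤ Q := by positivity
  have hsq := pow_lt_pow_left₀ hz (by positivity) two_ne_zero
  rw [mul_assoc 48, ← hQ, mul_pow, Real.sq_sqrt (div_nonneg (by linarith) (by linarith)),
    ← mul_div_assoc, div_lt_iff₀ (by linarith), mul_comm _ (n : ℝ)] at hsq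
  refine lt_of_le_of_lt ?_ hsq
  calc 288 * (h ^ 2 * L ^ 2) * Real.log α⁻¹
      = 288 * (h * L) ^ 2 * Real.log α⁻¹ := by rw [mul_pow]
    _ ≤ 288 * (2 * Q) ^ 2 * (2 * Real.log (Real.log n / α)) := by gcongr
    _ = _ := by ring
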